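/- An $(n,m,\mathfrak I)$ pliable index coding (PICOD) problem consists of $m$ messages $x_1,\dots,x_m$ at a server and $n$ receivers, where receiver $r\in[n]$ has a nonempty request-set $I_r\subseteq[m]$ and already knows the messages $x_i$, $i\in S_r=[m]\setminus I_r$. A linear scalar pliable index code of length $\ell$ over a finite field $\mathbb F$ consists of an $\mathbb F$-linear encoder $\phi:\mathbb F^m\to\mathbb F^\ell$ and $\mathbb F$-linear decoders $\psi_r:\mathbb F^\ell\times\mathbb F^{S_r}\to\mathbb F$, $r\in[n]$, such that for each $r$ there is some $d\in I_r$ with $\psi_r\big(\phi(x),(x_i)_{i\in S_r}\big)=x_d$ for all $x\in\mathbb F^m$; it is binary if $\mathbb F=\mathbb F_2$. Let $\mathcal H$ be the hypergraph with vertex set $[m]$ and edges $I_1,\dots,I_n$, and let $\ell_1^*(\mathcal H)$ be the smallest length of a linear scalar pliable index code over $\mathbb F$ for the problem. Corollary. There is an absolute constant $C>0$ such that the following holds for every $(n,m,\mathfrak I)$-PICOD problem. Let $$\Gamma=\max_{r\in[n]}\big|\{r'\in[n]\setminus\{r\}: I_r\cap I_{r'}\neq\emptyset\}\big| .$$ Then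 there exists a binary linear scalar pliable index code for the problem of length at most $$C\cdot\min\{\max\{1,\log^2\Gamma\},\,m,\,n\},$$ where $\log$ is the natural logarithm, and $\log^2\Gamma$ is disregarded (so that the maximum is $1$) when $\Gamma=0$. Moreover, for every finite field $\mathbb F$, $$\ell_1^*(\mathcal H)\le C\cdot\min\{\max\{1,\log^2\Gamma\},\,m,\,n\}.$$ In particular, over all problems with $\Gamma\ge2$, both lengths are $O(\min\{\log^2\Gamma,m,n\})$. -/

import Mathlib

/-- A pliable index coding (PICOD) problem with `n` receivers and `m` messages: receiver `r`
requests an arbitrary message with index in the nonempty set `requestSet r`. Equivalently, the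
hypergraph on the vertex set `Fin m` with the (indexed) edges `requestSet r`. -/
structure PICODProblem (n m : ℕ) where
  requestSet : Fin n → Finset (Fin m)
  requestSet_nonempty : ∀ r, (requestSet r).Nonempty

namespace PICODProblem

variable {n m : ℕ} (P : PICODProblem n m)

/-- The indices of the messages that receiver `r` already has. -/
def sideInfo (r : Fin n) : Finset (Fin m) := (P.requestSet r)ᶜ

/-- The maximum over the receivers `r` of the number of other receivers `r'` whose request-set
meets the request-set of `r` (it is `0` if there are no receivers). -/
def maxIncidence : ℕ :=
  Finset.univ.sup fun r : Fin n =>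
    (Finset.univ.filter fun r' : Fin n =>
      r' ≠ r ∧ (P.requestSet r ∩ P.requestSet r').Nonempty).card

/-- A pliable index code of length `ℓ` over the alphabet `A`: an encoder at the server, and for
every receiver `r` a decoder which, from the codeword and the side information of `r`, recovers
the message `x d` for some fixed index `d` in the request-set of `r`. -/
structure PliableIndexCode (A : Type*) (ℓ : ℕ) where
  encode : (Fin m → A) → (Fin ℓ → A)
  decode : (r : Fin n) → (Fin ℓ → A) × (P.sideInfo r → A) → A
  decode_correct : ∀ r : Fin n, ∃ d ∈ P.requestSet r, ∀ x : Fin m → A,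
    decode r (encode x, fun i => x i.1) = x d

/-- A code whose alphabet is the field `F` itself (a scalar code) is linear if its encoder and
all its decoders are `F`-linear. -/
def PliableIndexCode.IsLinear {P : PICODProblem n m} {F : Type*} [Field F] {ℓ : ℕ}
    (c : P.PliableIndexCode F ℓ) : Prop :=
  IsLinearMap F c.encode ∧ ∀ r, IsLinearMap F (c.decode r)

/-- There is a linear scalar pliable index code of length `ℓ` over `F`. -/
def HasLinearScalarCode (F : Type*) [Field F] (ℓ : ℕ) : Prop :=
  ∃ c : P.PliableIndexCode F ℓ, c.IsLinear

/-- Sending all messages uncoded is a linear scalar code of length `m`. -/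
theorem hasLinearScalarCode_uncoded (F : Type*) [Field F] : P.HasLinearScalarCode F m := by
  refine ⟨⟨id, fun r p => p.1 (P.requestSet_nonempty r).choose, fun r =>
    ⟨_, (P.requestSet_nonempty r).choose_spec, fun x => rfl⟩⟩, ?_, fun r => ?_⟩
  · exact ⟨fun _ _ => rfl, fun _ _ => rfl⟩
  · exact ⟨fun _ _ => rfl, fun _ _ => rfl⟩

open Classical in
/-- The smallest length of a linear scalar pliable index code over `F`. -/
noncomputable def optimalScalarLength (F : Type*) [Field F] : ℕ :=
  Nat.find (⟨m, P.hasLinearScalarCode_uncoded F⟩ : ∃ ℓ, P.HasLinearScalarCode F ℓ)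

end PICODProblem

/-! If the server sends the sum of the messages indexed by a set that meets `I_r` in exactly one
index, receiver `r` cancels what it knows and decodes. So it suffices to find few sets such that
every `I_r` meets one of them exactly once; the same sets then serve every field.

In a minimal transversal `T`, each vertex has a private edge meeting `T` only there. Private edges
of the vertices of `I_r ∩ T` are distinct and meet `I_r`, so `#(I_r ∩ T) ≤ Γ + 1`. Sorting receivers
by the dyadic size of `I_r ∩ T` leaves `O(log Γ)` classes for large `Γ`. Within a class, sampling
vertices at a rate inverse to that size isolates a vertex of a given edge with probability at least
`1/8`. After `O(log Γ)` samplings the failure probability is at most `1 / (4 * (Γ + 1))`, and the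
local lemma finds an outcome good for the whole class. The bounds `m` and `n` come from uncoded
transmission. -/

/-! ### The symmetric local lemma, by counting. -/

section LocalLemma

open Finset

variable {V α ι : Type*} [Fintype V] [DecidableEq V] [Fintype α] [DecidableEq ι]

open Classical in
/-- An event depending only on the coordinates in `e` is independent, under the uniform
distribution, of every event depending only on the other coordinates. -/
theorem card_filter_and_mul_card_of_dependsOn (e : Finset V) (A B : (V → α) → Prop)
    (hA : ∀ f g : V → α, (∀ v ∈ e, f v = g v) → A f → A g)
    (hB : ∀ f g : V → α, (∀ v ∉ e, f v = g v) → B f → B g) :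
    #{f | A f ∧ B f} * Fintype.card (V → α) = #{f | A f} * #{f | B f} := by
  -- Exchanging the `e`-coordinates of two assignments is an involution on pairs; it matches pairs
  -- with `A` and `B` both on the first entry to pairs with `A` on the first and `B` on the second.
  have hswap : ∀ f g : V → α, e.piecewise (e.piecewise f g) (e.piecewise g f) = f := by
    intro f g
    ext v
    by_cases hv : v ∈ e <;> simp [hv]
  rw [← Finset.card_univ, ← card_product, ← card_product]
  refine card_nbij' (fun q => (e.piecewise q.1 q.2, e.piecewise q.2 q.1))
    (fun q => (e.piecewise q.1 q.2, e.piecewise q.2 q.1)) ?_ ?_ ?_ ?_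
  · rintro ⟨f, g⟩ h
    simp only [coe_product, Set.mem_prod, mem_coe, mem_filter, mem_univ, true_and,
      and_true] at h ⊢
    exact ⟨hA f _ (fun v hv => by simp [hv]) h.1, hB f _ (fun v hv => by simp [hv]) h.2⟩
  · rintro ⟨f, g⟩ h
    simp only [coe_product, Set.mem_prod, mem_coe, mem_filter, mem_univ, true_and,
      and_true] at h ⊢
    exact ⟨hA f _ (fun v hv => by simp [hv]) h.1, hB g _ (fun v hv => by simp [hv]) h.2⟩
  · rintro ⟨f, g⟩ _
    simp [hswap]
  · rintro ⟨f, g⟩ _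
    simp [hswap]

open Classical in
/-- The inductive step of the counting form of the symmetric Lovász local lemma: avoiding one more
event keeps a `1 - 1 / (2 * (d + 1))` fraction of the assignments. -/
theorem le_card_filter_forall_insert_not [Fintype ι] (E : ι → Finset V)
    (bad : ι → (V → α) → Prop)
    (hbad : ∀ i, ∀ f g : V → α, (∀ v ∈ E i, f v = g v) → bad i f → bad i g) (d : ℕ)
    (hprob : ∀ i, 4 * (d + 1) * #{f | bad i f} ≤ Fintype.card (V → α))
    (hdeg : ∀ i, #{j | j ≠ i ∧ (E i ∩ E j).Nonempty} ≤ d) (S : Finset ι) (i : ι) (hi : i ∉ S) :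
    (1 - 1 / (2 * (d + 1)) : ℝ) * #{f | ∀ j ∈ S, ¬ bad j f} ≤
      #{f | ∀ j ∈ insert i S, ¬ bad j f} := by
  induction hS : #S using Nat.strong_induction_on generalizing S i with
  | _ k ih =>
  subst hS
  set x : ℝ := 1 / (2 * (d + 1)) with hx
  have hd : (0 : ℝ) < d + 1 := by positivity
  have hx0 : 0 ≤ x := by positivity
  have hxd : x * (2 * (d + 1)) = 1 := by rw [hx]; field_simp
  have hx1 : x ≤ 1 / 2 := by nlinarith [(Nat.cast_nonneg d : (0 : ℝ) ≤ d)]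
  set S₁ := S.filter fun j => (E i ∩ E j).Nonempty with hS₁
  set S₂ := S.filter fun j => ¬ (E i ∩ E j).Nonempty with hS₂
  have hunion : S₂ ∪ S₁ = S := by
    rw [union_comm]; exact filter_union_filter_not_eq _ _
  -- Neighbours of `i` are added to `S₂` one at a time; the induction hypothesis applies because the
  -- set avoided so far is strictly smaller than `S`.
  have hchain : ∀ T ⊆ S₁, (1 - x) ^ #T * #{f | ∀ j ∈ S₂, ¬ bad j f} ≤
      (#{f | ∀ j ∈ S₂ ∪ T, ¬ bad j f} : ℝ) := by
    intro T
    induction T using Finset.induction_on with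
    | empty => simp
    | insert a T ha ihT =>
      intro hT
      have haS : a ∈ S₁ := hT (mem_insert_self _ _)
      have ha₂ : a ∉ S₂ ∪ T := by
        rw [mem_union, not_or]
        refine ⟨fun h => (mem_filter.1 h).2 (mem_filter.1 haS).2, ha⟩
      have hss : S₂ ∪ T ⊂ S := by
        refine (Finset.ssubset_iff_of_subset ?_).2 ⟨a, (mem_filter.1 haS).1, ha₂⟩
        rw [← hunion]
        exact union_subset_union_right ((subset_insert _ _).trans hT)
      have h₁ := ih _ (card_lt_card hss) (S₂ ∪ T) a ha₂ rfl
      have h₂ := ihT ((subset_insert _ _).trans hT)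
      rw [card_insert_of_notMem ha, pow_succ', mul_assoc, union_insert]
      exact (mul_le_mul_of_nonneg_left h₂ (by linarith)).trans h₁
  -- Bernoulli: `(1 - x) ^ #S₁ ≥ 1 - d * x ≥ 1/2`.
  have hhalf : (1 / 2 : ℝ) * #{f | ∀ j ∈ S₂, ¬ bad j f} ≤ #{f | ∀ j ∈ S, ¬ bad j f} := by
    have h := hchain S₁ Subset.rfl
    rw [hunion] at h
    refine le_trans (mul_le_mul_of_nonneg_right ?_ (Nat.cast_nonneg _)) h
    have hcard : #S₁ ≤ d := by
      refine (card_le_card fun j hj => ?_).trans (hdeg i)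
      rw [hS₁, mem_filter] at hj
      refine mem_filter.2 ⟨mem_univ _, ?_, hj.2⟩
      rintro rfl
      exact hi hj.1
    have hcard' : (#S₁ : ℝ) ≤ d := by exact_mod_cast hcard
    have hb := one_add_mul_le_pow (a := -x) (by linarith) #S₁
    rw [← sub_eq_add_neg] at hb
    nlinarith
  -- Given that `S₂` is avoided, `bad i` keeps its probability, at most `x / 2`. Passing from `S₂`
  -- to `S` costs at most a factor `2`, hence the bound `x` in `hle`.
  have hindep : (#{f | bad i f ∧ ∀ j ∈ S₂, ¬ bad j f} : ℝ) * (2 * x⁻¹) ≤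
      #{f | ∀ j ∈ S₂, ¬ bad j f} := by
    have h : #{f | bad i f ∧ ∀ j ∈ S₂, ¬ bad j f} * Fintype.card (V → α) =
        #{f | bad i f} * #{f | ∀ j ∈ S₂, ¬ bad j f} := by
      convert card_filter_and_mul_card_of_dependsOn (E i) (bad i)
        (fun f => ∀ j ∈ S₂, ¬ bad j f) (hbad i) (by
          intro f g hfg hf j hj hgj
          refine hf j hj (hbad j g f (fun v hv => (hfg v fun hvi => ?_).symm) hgj)
          exact (mem_filter.1 hj).2 ⟨v, mem_inter.2 ⟨hvi, hv⟩⟩)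
    have hp := hprob i
    have hxinv : 2 * x⁻¹ = ((4 * (d + 1) : ℕ) : ℝ) := by
      rw [hx]; push_cast; field_simp; norm_num
    rw [hxinv]
    norm_cast
    rcases Nat.eq_zero_or_pos (Fintype.card (V → α)) with h0 | h0
    · have : #{f | bad i f ∧ ∀ j ∈ S₂, ¬ bad j f} ≤ 0 := h0 ▸ card_le_univ _
      simp [Nat.le_zero.1 this]
    · refine Nat.le_of_mul_le_mul_right ?_ h0
      calc _ = 4 * (d + 1) * (#{f | bad i f ∧ ∀ j ∈ S₂, ¬ bad j f} *
            Fintype.card (V → α)) := by ring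
        _ = (4 * (d + 1) * #{f | bad i f}) * #{f | ∀ j ∈ S₂, ¬ bad j f} := by
          rw [mul_assoc (4 * (d + 1)) #{f | bad i f}, ← h]
        _ ≤ _ := by rw [mul_comm]; exact Nat.mul_le_mul_left _ hp
  have hsplit : (#{f | ∀ j ∈ S, ¬ bad j f} : ℝ) ≤ #{f | ∀ j ∈ insert i S, ¬ bad j f} +
      #{f | bad i f ∧ ∀ j ∈ S₂, ¬ bad j f} := by
    norm_cast
    refine (card_le_card fun f hf => ?_).trans (card_union_le _ _)
    rw [mem_filter] at hf
    by_cases hb : bad i f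
    · exact mem_union_right _ (mem_filter.2 ⟨mem_univ _, hb, fun j hj =>
        hf.2 j (mem_filter.1 hj).1⟩)
    · exact mem_union_left _ (mem_filter.2 ⟨mem_univ _, (forall_mem_insert _ _ _).2 ⟨hb, hf.2⟩⟩)
  have hx' : 0 < x := by positivity
  have hle : (#{f | bad i f ∧ ∀ j ∈ S₂, ¬ bad j f} : ℝ) ≤ x * #{f | ∀ j ∈ S, ¬ bad j f} := by
    have h := hindep.trans (by linarith [hhalf] :
      _ ≤ 2 * (#{f | ∀ j ∈ S, ¬ bad j f} : ℝ))
    rw [← div_eq_mul_inv] at h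
    have h' := mul_le_mul_of_nonneg_left h hx0
    have : x * ((#{f | bad i f ∧ ∀ j ∈ S₂, ¬ bad j f} : ℝ) * (2 / x)) =
        2 * (#{f | bad i f ∧ ∀ j ∈ S₂, ¬ bad j f} : ℝ) := by field_simp
    linarith
  linarith

open Classical in
/-- The symmetric Lovász local lemma for events in a finite uniform product space. -/
theorem exists_forall_not_of_local [Fintype ι] [Nonempty α] (E : ι → Finset V)
    (bad : ι → (V → α) → Prop)
    (hbad : ∀ i, ∀ f g : V → α, (∀ v ∈ E i, f v = g v) → bad i f → bad i g) (d : ℕ)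
    (hprob : ∀ i, 4 * (d + 1) * #{f | bad i f} ≤ Fintype.card (V → α))
    (hdeg : ∀ i, #{j | j ≠ i ∧ (E i ∩ E j).Nonempty} ≤ d) :
    ∃ f, ∀ i, ¬ bad i f := by
  have hpos : ∀ S : Finset ι, 0 < #{f | ∀ j ∈ S, ¬ bad j f} := by
    intro S
    induction S using Finset.induction_on with
    | empty => simpa using Finset.card_pos.2 (univ_nonempty (α := V → α))
    | insert i S hi ih =>
      have h := le_card_filter_forall_insert_not E bad hbad d hprob hdeg S i hi
      have hx : (0 : ℝ) < 1 - 1 / (2 * (d + 1)) := by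
        rw [sub_pos, div_lt_one (by positivity)]
        linarith [(Nat.cast_nonneg d : (0 : ℝ) ≤ d)]
      have ih' : (0 : ℝ) < #{f | ∀ j ∈ S, ¬ bad j f} := by exact_mod_cast ih
      exact_mod_cast (mul_pos hx ih').trans_le h
  obtain ⟨f, hf⟩ := Finset.card_pos.1 (hpos univ)
  exact ⟨f, fun i => (mem_filter.1 hf).2 i (mem_univ i)⟩

end LocalLemma

/-! ### Isolating a vertex by random sampling. -/

section UniqueSampling

open Finset

variable {V : Type*} [Fintype V] [DecidableEq V]

/-- If every vertex is sampled with probability `1 / K`, then with probability at least `1 / 8`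
exactly one vertex of `e` is sampled, provided that `2 * #e ≤ K ≤ 4 * #e`. -/
theorem card_le_eight_mul_card_filter_unique (e : Finset V) (K : ℕ) [NeZero K]
    (h₁ : 2 * #e ≤ K) (h₂ : K ≤ 4 * #e) :
    Fintype.card (V → Fin K) ≤ 8 * #{b : V → Fin K | #{v ∈ e | b v = 0} = 1} := by
  have hK : 0 < K := Nat.pos_of_neZero K
  -- The value `0` means "sampled": `B v` consists of the outcomes that pick `v` and no other vertex
  -- of `e`.
  set B : V → Finset (V → Fin K) := fun v =>
    Fintype.piFinset fun u => if u ∈ e then (if u = v then {0} else {0}ᶜ) else univ with hB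
  have hcardB : ∀ v ∈ e, #(B v) = (K - 1) ^ (#e - 1) * K ^ #eᶜ := by
    intro v hv
    rw [hB, Fintype.card_piFinset, ← Finset.prod_mul_prod_compl e]
    congr 1
    · rw [← Finset.mul_prod_erase e _ hv, ← card_erase_of_mem hv]
      simp only [hv, if_true, card_singleton, one_mul]
      apply Finset.prod_eq_pow_card
      intro u hu
      rw [mem_erase] at hu
      simp [hu.1, hu.2, card_compl]
    · apply Finset.prod_eq_pow_card
      intro u hu
      rw [mem_compl] at hu
      simp [hu]
  have hdisj : (e : Set V).PairwiseDisjoint B := by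
    intro v hv w hw hvw
    refine Finset.disjoint_left.2 fun b hb hb' => ?_
    rw [hB, Fintype.mem_piFinset] at hb hb'
    have h1 := hb v
    have h2 := hb' v
    rw [mem_coe] at hv
    simp [hv] at h1
    simp [hv, hvw] at h2
    exact h2 h1
  have hsub : e.biUnion B ⊆ ({b : V → Fin K | #{v ∈ e | b v = 0} = 1} : Finset _) := by
    intro b hb
    obtain ⟨v, hv, hb⟩ := mem_biUnion.1 hb
    rw [hB, Fintype.mem_piFinset] at hb
    refine mem_filter.2 ⟨mem_univ _, card_eq_one.2 ⟨v, ?_⟩⟩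
    ext u
    have hu := hb u
    rw [mem_filter, mem_singleton]
    by_cases hue : u ∈ e
    · by_cases huv : u = v
      · subst huv; simpa [hue] using hu
      · simpa [hue, huv] using hu
    · simp only [hue, false_and, false_iff]
      rintro rfl
      exact hue hv
  have hcard := card_le_card hsub
  rw [card_biUnion hdisj, sum_congr rfl hcardB, sum_const, smul_eq_mul] at hcard
  refine le_trans ?_ (Nat.mul_le_mul_left 8 hcard)
  have hsplit : Fintype.card (V → Fin K) = K ^ #e * K ^ #eᶜ := by
    rw [Fintype.card_fun, Fintype.card_fin, ← pow_add, card_add_card_compl]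
  rw [hsplit, ← mul_assoc, ← mul_assoc]
  refine Nat.mul_le_mul_right _ ?_
  obtain ⟨s, hs⟩ : ∃ s, #e = s + 1 := ⟨#e - 1, by omega⟩
  rw [hs] at h₁ h₂ ⊢
  obtain ⟨k, rfl⟩ : ∃ k, K = k + 1 := ⟨K - 1, by omega⟩
  simp only [Nat.add_sub_cancel]
  have hk : (0 : ℝ) < k + 1 := by positivity
  -- This is `(1 - 1/K) ^ (#e - 1) ≥ 1/2`, from Bernoulli and `2 * #e ≤ K`. The remaining factor `K`
  -- is absorbed by `K ≤ 4 * #e`.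
  have hbern : (k + 1 : ℝ) ^ s ≤ 2 * (k : ℝ) ^ s := by
    have h := one_add_mul_le_pow (a := -(1 / (k + 1) : ℝ)) (by
      have : (1 : ℝ) / (k + 1) ≤ 1 := by
        rw [div_le_one hk]; linarith [(Nat.cast_nonneg k : (0 : ℝ) ≤ k)]
      linarith) s
    have h1 : (1 : ℝ) + -(1 / (k + 1)) = k / (k + 1) := by field_simp; ring
    have h2 : (1 / 2 : ℝ) ≤ 1 + s * -(1 / (k + 1)) := by
      have : (s : ℝ) / (k + 1) ≤ 1 / 2 := by
        rw [div_le_div_iff₀ hk (by norm_num)]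
        exact_mod_cast (by omega : s * 2 ≤ 1 * (k + 1))
      have h3 : (s : ℝ) * -(1 / (k + 1)) = -(s / (k + 1)) := by ring
      rw [h3]; linarith
    rw [h1, div_pow] at h
    have h4 := h2.trans h
    rw [div_le_div_iff₀ (by norm_num) (by positivity)] at h4
    linarith
  have hbern' : (k + 1) ^ s ≤ 2 * k ^ s := by exact_mod_cast hbern
  calc (k + 1) ^ (s + 1) = (k + 1) * (k + 1) ^ s := by ring
    _ ≤ (4 * (s + 1)) * (2 * k ^ s) := Nat.mul_le_mul h₂ hbern'
    _ = 8 * (s + 1) * k ^ s := by ring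

/-- The number of `t`-fold independent samplings none of which samples exactly one vertex
of `e`. -/
theorem card_filter_forall_not_unique (e : Finset V) (K t : ℕ) [NeZero K] :
    #{f : V → Fin t → Fin K | ∀ τ, #{v ∈ e | f v τ = 0} ≠ 1} =
      #{b : V → Fin K | #{v ∈ e | b v = 0} ≠ 1} ^ t := by
  have h : #(Fintype.piFinset fun _ : Fin t =>
      ({b : V → Fin K | #{v ∈ e | b v = 0} ≠ 1} : Finset _)) =
      #{b : V → Fin K | #{v ∈ e | b v = 0} ≠ 1} ^ t := by
    simp [Fintype.card_piFinset]
  rw [← h]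
  refine card_nbij' (fun f τ v => f v τ) (fun f v τ => f τ v) ?_ ?_ ?_ ?_
  · intro f hf
    simpa [Fintype.mem_piFinset] using hf
  · intro f hf
    simpa [Fintype.mem_piFinset] using hf
  · intro f _; rfl
  · intro f _; rfl

/-- Since `(7/8) ^ 6 < 1/2`, each block of six independent samplings at least halves the failure
probability. -/
theorem card_filter_forall_not_unique_le (e : Finset V) (K q : ℕ) [NeZero K]
    (h₁ : 2 * #e ≤ K) (h₂ : K ≤ 4 * #e) :
    2 ^ q * #{f : V → Fin (6 * q) → Fin K | ∀ τ, #{v ∈ e | f v τ = 0} ≠ 1} ≤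
      Fintype.card (V → Fin (6 * q) → Fin K) := by
  have h := card_le_eight_mul_card_filter_unique e K h₁ h₂
  have hadd : #{b : V → Fin K | #{v ∈ e | b v = 0} = 1} +
      #{b : V → Fin K | #{v ∈ e | b v = 0} ≠ 1} = Fintype.card (V → Fin K) := by
    rw [← Finset.card_univ]; exact card_filter_add_card_filter_not _
  have h8 : 8 * #{b : V → Fin K | #{v ∈ e | b v = 0} ≠ 1} ≤
      7 * Fintype.card (V → Fin K) := by omega
  have hcard : Fintype.card (V → Fin (6 * q) → Fin K) =
      (Fintype.card (V → Fin K) ^ 6) ^ q := by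
    simp only [Fintype.card_fun, Fintype.card_fin, ← pow_mul]
    congr 1; ring
  rw [card_filter_forall_not_unique, hcard, pow_mul, ← mul_pow]
  refine Nat.pow_le_pow_left ?_ q
  generalize #{b : V → Fin K | #{v ∈ e | b v = 0} ≠ 1} = a at h8 ⊢
  generalize Fintype.card (V → Fin K) = N at h8 ⊢
  have h6 := Nat.pow_le_pow_left h8 6
  rw [mul_pow, mul_pow] at h6
  norm_num at h6
  omega

open Classical in
/-- A family of edges of comparable sizes, each meeting few others, admits few vertex sets such
that each edge meets one of them in exactly one vertex. -/
theorem exists_sets_inter_card_eq_one {ι : Type*} [Fintype ι] [DecidableEq ι]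
    (E : ι → Finset V) (d q K : ℕ) (hK : 0 < K)
    (h₁ : ∀ i, 2 * #(E i) ≤ K) (h₂ : ∀ i, K ≤ 4 * #(E i))
    (hq : 4 * (d + 1) ≤ 2 ^ q)
    (hdeg : ∀ i, #{j | j ≠ i ∧ (E i ∩ E j).Nonempty} ≤ d) :
    ∃ A : Fin (6 * q) → Finset V, ∀ i, ∃ τ, #(E i ∩ A τ) = 1 := by
  have : NeZero K := ⟨hK.ne'⟩
  -- A coordinate of the product space records all samplings of one vertex, so failure at `i`
  -- depends only on the coordinates in `E i`.
  obtain ⟨f, hf⟩ := exists_forall_not_of_local (α := Fin (6 * q) → Fin K) E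
    (fun i f => ∀ τ, #{v ∈ E i | f v τ = 0} ≠ 1)
    (by
      intro i f g hfg hf τ
      rw [← filter_congr (p := fun v => f v τ = 0) fun v hv => by rw [hfg v hv]]
      exact hf τ) d
    (fun i => by
      have h := card_filter_forall_not_unique_le (E i) K q (h₁ i) (h₂ i)
      refine le_trans (Nat.mul_le_mul_right _ hq) (le_trans (le_of_eq ?_) h)
      congr!) hdeg
  refine ⟨fun τ => {v | f v τ = 0}, fun i => ?_⟩
  obtain ⟨τ, hτ⟩ := not_forall.1 (hf i)
  refine ⟨τ, ?_⟩
  rw [not_not] at hτ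
  rw [← hτ]
  congr 1
  ext v
  simp

end UniqueSampling

/-! ### From isolating sets to codes. -/

namespace PICODProblem

open Finset

variable {n m : ℕ} (P : PICODProblem n m)

/-- Sending the sums of the messages over sets of indices is a linear code as soon as every
request-set meets one of these sets in exactly one index. -/
theorem hasLinearScalarCode_of_inter_card_eq_one (F : Type*) [Field F] {ℓ : ℕ}
    (A : Fin ℓ → Finset (Fin m)) (hA : ∀ r, ∃ τ, #(P.requestSet r ∩ A τ) = 1) :
    P.HasLinearScalarCode F ℓ := by
  choose τ hτ using hA
  refine ⟨⟨fun x t => ∑ i ∈ A t, x i,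
    fun r p => p.1 (τ r) - ∑ i : P.sideInfo r, if i.1 ∈ A (τ r) then p.2 i else 0,
    fun r => ?_⟩, ?_, fun r => ?_⟩
  · obtain ⟨d, hd⟩ := card_eq_one.1 (hτ r)
    have hmem : d ∈ P.requestSet r ∩ A (τ r) := by rw [hd]; exact mem_singleton_self d
    refine ⟨d, (mem_inter.1 hmem).1, fun x => ?_⟩
    have h1 : ∑ i : P.sideInfo r, (if i.1 ∈ A (τ r) then x i.1 else 0) =
        ∑ i ∈ P.sideInfo r, if i ∈ A (τ r) then x i else 0 :=
      Finset.sum_coe_sort (P.sideInfo r) fun i => if i ∈ A (τ r) then x i else 0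
    have h2 : ∑ i ∈ P.requestSet r, (if i ∈ A (τ r) then x i else 0) = x d := by
      rw [← sum_filter, filter_mem_eq_inter, hd, sum_singleton]
    have h3 : ∑ i ∈ A (τ r), x i = ∑ i, if i ∈ A (τ r) then x i else 0 := by
      rw [← sum_filter, filter_mem_eq_inter, univ_inter]
    dsimp only
    rw [h1, h3, ← Finset.sum_add_sum_compl (P.requestSet r), h2, sideInfo, add_sub_cancel_right]
  · refine ⟨fun x y => ?_, fun c x => ?_⟩
    · ext t; simp [sum_add_distrib]
    · ext t; simp [mul_sum]
  · refine ⟨fun x y => ?_, fun c x => ?_⟩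
    · have : ∀ i : P.sideInfo r, (if i.1 ∈ A (τ r) then x.2 i + y.2 i else 0) =
          (if i.1 ∈ A (τ r) then x.2 i else 0) + if i.1 ∈ A (τ r) then y.2 i else 0 := by
        intro i; split_ifs <;> simp
      simp only [Prod.fst_add, Prod.snd_add, Pi.add_apply, this, sum_add_distrib]
      ring
    · simp only [Prod.smul_fst, Prod.smul_snd, Pi.smul_apply, smul_eq_mul, mul_sub, mul_sum,
        mul_ite, mul_zero]

/-- A minimal set of indices that meets all request-sets meets each of them in at most
`P.maxIncidence + 1` indices. -/
theorem exists_transversal_inter_card_le :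
    ∃ T : Finset (Fin m), ∀ r, (P.requestSet r ∩ T).Nonempty ∧
      #(P.requestSet r ∩ T) ≤ P.maxIncidence + 1 := by
  obtain ⟨T, hT⟩ := (Set.toFinite
    {T : Finset (Fin m) | ∀ r, (P.requestSet r ∩ T).Nonempty}).exists_minimal
    ⟨univ, fun r => by simpa using P.requestSet_nonempty r⟩
  refine ⟨T, fun r => ⟨hT.prop r, ?_⟩⟩
  -- Otherwise `T.erase v` would still meet every request-set, against minimality.
  have hpriv : ∀ v ∈ T, ∃ r, P.requestSet r ∩ T = {v} := by
    intro v hv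
    by_contra! hne
    have hmem : T.erase v ∈ {T : Finset (Fin m) | ∀ r, (P.requestSet r ∩ T).Nonempty} := by
      intro r
      by_contra hempty
      rw [not_nonempty_iff_eq_empty] at hempty
      refine hne r (eq_singleton_iff_nonempty_unique_mem.2 ⟨hT.prop r, fun w hw => ?_⟩)
      by_contra hwv
      rw [mem_inter] at hw
      have : w ∈ P.requestSet r ∩ T.erase v := mem_inter.2 ⟨hw.1, mem_erase.2 ⟨hwv, hw.2⟩⟩
      rw [hempty] at this
      exact notMem_empty _ this
    exact notMem_erase v T (hT.le_of_le hmem (erase_subset v T) hv)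
  have : Nonempty (Fin n) := ⟨r⟩
  choose! g hg using hpriv
  set N := univ.filter fun r' : Fin n =>
    r' ≠ r ∧ (P.requestSet r ∩ P.requestSet r').Nonempty with hN
  have hle : #N ≤ P.maxIncidence := Finset.le_sup (f := fun r : Fin n => #{r' : Fin n |
    r' ≠ r ∧ (P.requestSet r ∩ P.requestSet r').Nonempty}) (mem_univ r)
  have hcard : #(P.requestSet r ∩ T) ≤ #(insert r N) := by
    refine card_le_card_of_injOn g (fun v hv => ?_) fun v hv w hw hvw => ?_
    · rw [mem_coe, mem_inter] at hv
      rw [mem_coe, mem_insert]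
      by_cases h : g v = r
      · exact Or.inl h
      · have hvg : v ∈ P.requestSet (g v) ∩ T := by rw [hg v hv.2]; exact mem_singleton_self v
        exact Or.inr (mem_filter.2 ⟨mem_univ _, h, v, mem_inter.2 ⟨hv.1, (mem_inter.1 hvg).1⟩⟩)
    · rw [mem_coe, mem_inter] at hv hw
      have h1 := hg v hv.2
      rw [hvw, hg w hw.2] at h1
      exact (singleton_injective h1).symm
  exact hcard.trans ((card_insert_le _ _).trans (Nat.succ_le_succ hle))

/-- There are polylogarithmically many (in the incidence) sets of indices such that every
request-set meets one of them in exactly one index. -/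
theorem exists_sets_requestSet_inter_card_eq_one (q : ℕ) (hq : P.maxIncidence + 1 < 2 ^ q) :
    ∃ A : Fin (q * (6 * (q + 2))) → Finset (Fin m),
      ∀ r, ∃ τ, #(P.requestSet r ∩ A τ) = 1 := by
  classical
  obtain ⟨T, hT⟩ := P.exists_transversal_inter_card_le
  have hlevel : ∀ j : Fin q, ∃ A : Fin (6 * (q + 2)) → Finset (Fin m),
      ∀ r : {r : Fin n // Nat.log 2 #(P.requestSet r ∩ T) = j},
        ∃ τ, #((P.requestSet r ∩ T) ∩ A τ) = 1 := by
    intro j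
    have hpow : ∀ r : {r : Fin n // Nat.log 2 #(P.requestSet r ∩ T) = j},
        2 ^ (j : ℕ) ≤ #(P.requestSet r ∩ T) ∧ #(P.requestSet r ∩ T) < 2 ^ ((j : ℕ) + 1) := by
      rintro ⟨r, hr⟩
      have hne := (hT r).1.card_pos.ne'
      have h₁ := Nat.pow_log_le_self 2 hne
      have h₂ := Nat.lt_pow_succ_log_self one_lt_two #(P.requestSet r ∩ T)
      rw [hr] at h₁ h₂
      exact ⟨h₁, h₂⟩
    -- Sizes in `[2 ^ j, 2 ^ (j + 1))` make `K = 2 ^ (j + 2)` admissible, and `q + 2` gives `4 * (Γ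
    -- + 1) ≤ 2 ^ (q + 2)`. Restriction to `T` and to one class cannot increase incidences.
    refine exists_sets_inter_card_eq_one
      (fun r : {r : Fin n // Nat.log 2 #(P.requestSet r ∩ T) = j} => P.requestSet r ∩ T)
      P.maxIncidence (q + 2) (2 ^ ((j : ℕ) + 2)) (by positivity) ?_ ?_ ?_ ?_
    · intro r
      have := (hpow r).2
      simp only [pow_succ] at this ⊢
      omega
    · intro r
      have := (hpow r).1
      simp only [pow_succ] at this ⊢
      omega
    · simp only [pow_succ]
      omega
    · intro r
      refine le_trans ?_ (Finset.le_sup (f := fun r : Fin n => #{r' : Fin n |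
        r' ≠ r ∧ (P.requestSet r ∩ P.requestSet r').Nonempty}) (mem_univ r.1))
      refine card_le_card_of_injOn Subtype.val (fun r' hr' => ?_) Subtype.val_injective.injOn
      rw [mem_coe, mem_filter] at hr'
      obtain ⟨v, hv⟩ := hr'.2.2
      simp only [mem_inter] at hv
      exact mem_coe.2 (mem_filter.2 ⟨mem_univ _, fun h => hr'.2.1 (Subtype.ext h),
        v, mem_inter.2 ⟨hv.1.1, hv.2.1⟩⟩)
  choose A hA using hlevel
  refine ⟨fun t => T ∩ A (finProdFinEquiv.symm t).1 (finProdFinEquiv.symm t).2, fun r => ?_⟩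
  have hlog : Nat.log 2 #(P.requestSet r ∩ T) < q :=
    Nat.log_lt_of_lt_pow (hT r).1.card_pos.ne' ((hT r).2.trans_lt hq)
  obtain ⟨τ, hτ⟩ := hA ⟨_, hlog⟩ ⟨r, rfl⟩
  refine ⟨finProdFinEquiv (⟨_, hlog⟩, τ), ?_⟩
  dsimp only
  rw [Equiv.symm_apply_apply, ← inter_assoc]
  exact hτ

/-- Sending one requested message per receiver is a linear scalar code of length `n`. -/
theorem hasLinearScalarCode_receivers (F : Type*) [Field F] : P.HasLinearScalarCode F n := by
  refine P.hasLinearScalarCode_of_inter_card_eq_one F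
    (fun r => {(P.requestSet_nonempty r).choose}) fun r => ⟨r, ?_⟩
  rw [inter_singleton_of_mem (P.requestSet_nonempty r).choose_spec, card_singleton]

end PICODProblem

/-! ### The numerical bound and the conclusion. -/

/-- For `Γ ≥ 2`, `Γ + 1 ≤ Γ ^ 2` bounds the binary logarithm by `3 * log Γ`; as `log Γ ≥ log 2`, the
additive constants are absorbed, and `6 * 5 * 8 = 240`. For `Γ = 0`, `Real.log 0 = 0` makes the
maximum `1`, as the convention requires. -/
theorem length_le_mul_max_one_log_sq (Γ : ℕ) :
    (((Nat.log 2 (Γ + 1) + 1) * (6 * (Nat.log 2 (Γ + 1) + 1 + 2)) : ℕ) : ℝ) ≤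
      240 * max 1 (Real.log Γ ^ 2) := by
  rcases Nat.lt_or_ge Γ 2 with hΓ | hΓ
  · have hlog : Nat.log 2 (Γ + 1) ≤ 1 :=
      Nat.lt_succ_iff.1 (Nat.log_lt_of_lt_pow (by omega) (by omega))
    have h : (Nat.log 2 (Γ + 1) + 1) * (6 * (Nat.log 2 (Γ + 1) + 1 + 2)) ≤ 240 := by
      interval_cases Nat.log 2 (Γ + 1) <;> norm_num
    have h' : (((Nat.log 2 (Γ + 1) + 1) * (6 * (Nat.log 2 (Γ + 1) + 1 + 2)) : ℕ) : ℝ) ≤ 240 := by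
      exact_mod_cast h
    linarith [le_max_left 1 (Real.log Γ ^ 2)]
  · have hΓ' : (2 : ℝ) ≤ Γ := by exact_mod_cast hΓ
    have hlog2 := Real.log_two_gt_d9
    set L := Real.log Γ with hL
    have hL2 : Real.log 2 ≤ L := Real.log_le_log (by norm_num) hΓ'
    have hpow : ((2 : ℝ)) ^ Nat.log 2 (Γ + 1) ≤ (Γ : ℝ) ^ 2 := by
      have h := Nat.pow_log_le_self 2 (show Γ + 1 ≠ 0 by omega)
      have h' : ((2 : ℝ)) ^ Nat.log 2 (Γ + 1) ≤ (Γ : ℝ) + 1 := by exact_mod_cast h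
      nlinarith
    have hq := Real.log_le_log (by positivity) hpow
    rw [Real.log_pow, Real.log_pow, ← hL] at hq
    set k : ℝ := (Nat.log 2 (Γ + 1) : ℝ) with hk
    have hk0 : 0 ≤ k := Nat.cast_nonneg _
    have hk3 : k ≤ 3 * L := by push_cast at hq; nlinarith
    have h1 : k + 1 ≤ 5 * L := by linarith
    have h2 : k + 1 + 2 ≤ 8 * L := by linarith
    have hprod : (k + 1) * (k + 1 + 2) ≤ (5 * L) * (8 * L) :=
      mul_le_mul h1 h2 (by linarith) (by linarith)
    push_cast
    rw [← hk]
    nlinarith [le_max_right 1 (L ^ 2)]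

/-- The length is chosen before the field, so one bound covers both the binary code and every
`optimalScalarLength`. -/
theorem PICODProblem.exists_hasLinearScalarCode {n m : ℕ} (P : PICODProblem n m) :
    ∃ ℓ : ℕ, (ℓ : ℝ) ≤ 240 * min (max 1 (Real.log (P.maxIncidence : ℝ) ^ 2))
        (min (m : ℝ) (n : ℝ)) ∧
      ∀ (F : Type*) [Field F], P.HasLinearScalarCode F ℓ := by
  obtain ⟨A, hA⟩ := P.exists_sets_requestSet_inter_card_eq_one
    (Nat.log 2 (P.maxIncidence + 1) + 1) (Nat.lt_pow_succ_log_self one_lt_two _)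
  have hlen := length_le_mul_max_one_log_sq P.maxIncidence
  rw [mul_min_of_nonneg _ _ (by norm_num), mul_min_of_nonneg _ _ (by norm_num)]
  rcases min_choice (240 * max 1 (Real.log (P.maxIncidence : ℝ) ^ 2))
    (min (240 * (m : ℝ)) (240 * n)) with h | h <;> rw [h]
  · exact ⟨_, hlen, fun F _ => P.hasLinearScalarCode_of_inter_card_eq_one F A hA⟩
  · rcases min_choice (240 * (m : ℝ)) (240 * n) with h' | h' <;> rw [h']
    · exact ⟨m, by linarith [(Nat.cast_nonneg m : (0 : ℝ) ≤ m)],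
        fun F _ => P.hasLinearScalarCode_uncoded F⟩
    · exact ⟨n, by linarith [(Nat.cast_nonneg n : (0 : ℝ) ≤ n)],
        fun F _ => P.hasLinearScalarCode_receivers F⟩

theorem mainTheorem2 :
    ∃ C : ℝ, 0 < C ∧ ∀ (n m : ℕ) (P : PICODProblem n m),
      (∃ ℓ : ℕ, P.HasLinearScalarCode (ZMod 2) ℓ ∧
        (ℓ : ℝ) ≤ C * min (max 1 (Real.log (P.maxIncidence : ℝ) ^ 2)) (min (m : ℝ) (n : ℝ))) ∧
      ∀ (F : Type*) [Field F] [Finite F],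
        (P.optimalScalarLength F : ℝ) ≤
          C * min (max 1 (Real.log (P.maxIncidence : ℝ) ^ 2)) (min (m : ℝ) (n : ℝ)) := by
  classical
  refine ⟨240, by norm_num, fun n m P => ⟨?_, fun F _ _ => ?_⟩⟩
  · obtain ⟨ℓ, hℓ, hcode⟩ := P.exists_hasLinearScalarCode
    exact ⟨ℓ, hcode (ZMod 2), hℓ⟩
  · obtain ⟨ℓ, hℓ, hcode⟩ := P.exists_hasLinearScalarCode
    refine le_trans ?_ hℓ
    exact_mod_cast Nat.find_min' _ (hcode F)
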